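/- Let $n\ge 2$ and let $C\in\mathbb{R}^{n\times n}$ be row-stochastic and irreducible with zero diagonal. Let $\Delta_n$ be the standard simplex with vertices $e_1,\dots,e_n$, and for $x\in\Delta_n$ put $W(x)=\operatorname{diag}(x)+(I-\operatorname{diag}(x))C$. A dominant left eigenvector of a row-stochastic matrix $W$ is a $w\in\Delta_n$ with $w^\top W=w^\top$. The single-timescale DF model is $$x(t+1)=F(x(t)):=C^\top\bigl(x(t)-x(t)^2\bigr)+x(t)^2=W(x(t))^\top x(t)$$ (squares entrywise). The (two-timescale) DF model of Jia et al. is: $y(s+1)$ is the dominant left eigenvector of $W(y(s))$. (1) For every non-autocratic initial state $x_0\in\Delta_n\setminus\{e_1,\dots,e_n\}$ the DF model has exactly one trajectory with $y(0)=x_0$, and there is $x^*\in\Delta_n$, an equilibrium of both models, such that the single-timescale trajectory with $x(0)=x_0$ and the DF trajectory with $y(0)=x_0$ both converge to $x^*$. (2) If $n\ge 3$, then $C$ has a unique dominant left eigenvector $c$ (the eigenvector centrality scores), it has positive entries, and $x^*$ in (1) can be taken to depend on $C$ only, not on $x_0$. Social power is accumulated at the individuals with high $c_i$, in the following sense: (a)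 if $C$ has star topology with center $k$ (that is, $c_{ij}=0$ whenever $i\ne k$ and $j\neq k$), then $c_k>c_i$ for all $i\ne k$, and $x^*=e_k$; (b) if $C$ does not have star topology, then $x^*_i>0$ for all $i$; $c_i=c_j$ implies $x^*_i=x^*_j$; and $c_i<c_j$ implies $x_i^*<x_j^*$ and $x^*_i/c_i<x^*_j/c_j$; (c) in both cases there is a threshold $\theta\in\mathbb{R}$ such that for every $i$: $x^*_i\ge c_i$ if $c_i\ge\theta$; $x^*_i>c_i$ if $c_i>\theta$; and $x^*_i<c_i$ if $c_i<\theta$. -/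

import Mathlib

open Filter Topology

/-- `C` is a relative interaction matrix: row-stochastic with zero diagonal. -/
def IsRelativeInteraction {n : ℕ} (C : Matrix (Fin n) (Fin n) ℝ) : Prop :=
  C ∈ Matrix.rowStochastic ℝ (Fin n) ∧ ∀ i, C i i = 0

/-- The non-autocratic states: the simplex without its vertices `e_1, …, e_n`. -/
def nonAutocratic (n : ℕ) : Set (Fin n → ℝ) :=
  stdSimplex ℝ (Fin n) \ Set.range (fun i => (Pi.single i 1 : Fin n → ℝ))

/-- `w` is a dominant left eigenvector of `W`: a left eigenvector for the eigenvalue `1`,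
normalized to lie in the simplex. -/
def IsDominantLeftEigenvector {n : ℕ} (W : Matrix (Fin n) (Fin n) ℝ) (w : Fin n → ℝ) : Prop :=
  w ∈ stdSimplex ℝ (Fin n) ∧ Matrix.vecMul w W = w

/-- The influence matrix `W(x) = diag(x) + (I - diag(x)) C`. -/
def influenceMatrix {n : ℕ} (C : Matrix (Fin n) (Fin n) ℝ) (x : Fin n → ℝ) :
    Matrix (Fin n) (Fin n) ℝ :=
  Matrix.diagonal x + (1 - Matrix.diagonal x) * C

/-- One step of the single-timescale DF model: `F(x) = Cᵀ (x - x²) + x²`, with `x²` taken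
entrywise. -/
def singleTimescaleStep {n : ℕ} (C : Matrix (Fin n) (Fin n) ℝ) (x : Fin n → ℝ) : Fin n → ℝ :=
  Matrix.mulVec C.transpose (x - x ^ 2) + x ^ 2

/-- The step is also `W(x)ᵀ x`. -/
theorem singleTimescaleStep_eq {n : ℕ} (C : Matrix (Fin n) (Fin n) ℝ) (x : Fin n → ℝ) :
    singleTimescaleStep C x = Matrix.mulVec (influenceMatrix C x).transpose x := by
  ext i
  simp [singleTimescaleStep, influenceMatrix, Matrix.mulVec, dotProduct, sub_mul,
    Matrix.diagonal_apply, add_mul, Finset.sum_add_distrib, mul_sub, Finset.sum_sub_distrib]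
  rw [Finset.sum_congr rfl (fun j _ => show C j i * x j ^ 2 = x j * C j i * x j by ring)]
  ring

/-- The self-weights `t ↦ x(t)` of the single-timescale DF model started at `x₀`. -/
def singleTimescaleTrajectory {n : ℕ} (C : Matrix (Fin n) (Fin n) ℝ) (x₀ : Fin n → ℝ) (t : ℕ) :
    Fin n → ℝ :=
  (singleTimescaleStep C)^[t] x₀

/-- `y` is a trajectory of the (two-timescale) DF model started at `x₀`: the self-weights for the
next issue are the dominant left eigenvector of the influence matrix of the current issue. -/
def IsDFTrajectory {n : ℕ} (C : Matrix (Fin n) (Fin n) ℝ) (x₀ : Fin n → ℝ) (y : ℕ → Fin n → ℝ) :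
    Prop :=
  y 0 = x₀ ∧ ∀ s, IsDominantLeftEigenvector (influenceMatrix C (y s)) (y (s + 1))

/-- `x` is an equilibrium, in the simplex, of the single-timescale DF model. -/
def IsSingleTimescaleEquilibrium {n : ℕ} (C : Matrix (Fin n) (Fin n) ℝ) (x : Fin n → ℝ) : Prop :=
  x ∈ stdSimplex ℝ (Fin n) ∧ singleTimescaleStep C x = x

/-- `x` is an equilibrium, in the simplex, of the (two-timescale) DF model. -/
def IsDFEquilibrium {n : ℕ} (C : Matrix (Fin n) (Fin n) ℝ) (x : Fin n → ℝ) : Prop :=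
  IsDominantLeftEigenvector (influenceMatrix C x) x

/-- `xs` is an equilibrium of both models, and both models started at `x₀` converge to it. -/
def BothConvergeTo {n : ℕ} (C : Matrix (Fin n) (Fin n) ℝ) (x₀ xs : Fin n → ℝ) : Prop :=
  IsSingleTimescaleEquilibrium C xs ∧ IsDFEquilibrium C xs ∧
    Tendsto (singleTimescaleTrajectory C x₀) atTop (𝓝 xs) ∧
    ∃ y, IsDFTrajectory C x₀ y ∧ Tendsto y atTop (𝓝 xs)

/-- The digraph of `C` has star topology with center `k`: every edge starts or ends at `k`. -/
def IsStarWithCenter {n : ℕ} (C : Matrix (Fin n) (Fin n) ℝ) (k : Fin n) : Prop :=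
  ∀ i j, i ≠ k → j ≠ k → C i j = 0

/-!
# Convergence of the single-timescale and two-timescale DF models

The centrality vector `c` is the Perron eigenvector of `C`. In the two-timescale model `w` follows
`y` exactly when `w ∈ Δ` and `w i * (1 - y i)` is proportional to `c i`; hence both models have the
same equilibria, the states with `p i * (1 - p i)` proportional to `c i` (`equilibriumSet`).

Each model has a strict Lyapunov function. Along the single-timescale model
`∑ i, (x i ^ 2 / 2 - x i ^ 3 / 3) / c i` decreases by at least a positive multiple of the cubed
size of the step (`singleTimescaleEnergy_step`), because `v ↦ v C` does not increase
`∑ i, v i ^ 2 / c i`. Along the two-timescale model the relative entropy to `c` plus a concave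
function decreases by at least the squared step over four (`dfEnergy_step`), because the model
minimizes this function with its concave part linearized. Steps therefore tend to zero and cluster
points are equilibria. For `n ≥ 3` there are finitely many equilibria, the vertices and at most one
state without autocrat (`equilibrium_unique`), so every trajectory converges
(`exists_tendsto_of_finite_clusterPt`). Neither aperiodicity of `C` nor monotonicity of the step is
needed.

A vertex `e_k` with `c k < 1 / 2` repels both models (`df_not_tendsto_single`,
`singleTimescale_not_tendsto_single`). Always `c k ≤ 1 / 2`, with equality exactly for the center of
a star. So without star topology the limit is the equilibrium without autocrat, whose existence is
a by-product of convergence; with star topology there is no such equilibrium, and the center is the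
only vertex left. In the former case `p i * (1 - p i)` is proportional to `c i` while
`p i + p j < 1` for `i ≠ j`, so `p i` and `p i / c i` increase with `c i`, which gives the
comparisons and the threshold. For `n = 2` every state is an equilibrium.
-/

/-! ### Irreducible stochastic matrices and the centrality vector -/

/-- Induction along the edges of the digraph of an irreducible matrix: a property that holds at
one vertex and passes along edges holds everywhere. -/
theorem Matrix.IsIrreducible.forall_of_edge {n : ℕ} {C : Matrix (Fin n) (Fin n) ℝ}
    (hirr : C.IsIrreducible) {P : Fin n → Prop} {i : Fin n} (hi : P i)
    (hP : ∀ i j, 0 < C i j → P i → P j) (j : Fin n) : P j := by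
  let : Quiver (Fin n) := C.toQuiver
  obtain ⟨p, -⟩ := hirr.connected i j
  clear * - hi hP p
  induction p with
  | nil => exact hi
  | cons _ e ih => exact hP _ _ e.down ih

theorem pos_of_vecMul_eq_self {n : ℕ} {C : Matrix (Fin n) (Fin n) ℝ} (hirr : C.IsIrreducible)
    {v : Fin n → ℝ} (hv : ∀ i, 0 ≤ v i) (hne : v ≠ 0) (hfix : Matrix.vecMul v C = v)
    (i : Fin n) : 0 < v i := by
  obtain ⟨k, hk⟩ := Function.ne_iff.1 hne
  refine hirr.forall_of_edge (P := fun i => 0 < v i) (lt_of_le_of_ne (hv k) (Ne.symm hk)) ?_ i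
  intro a b hab ha
  have h := congrFun hfix b
  rw [← h]
  exact Finset.sum_pos' (fun j _ => mul_nonneg (hv j) (hirr.nonneg j b))
    ⟨a, Finset.mem_univ a, mul_pos ha hab⟩

/-- The kernel of `v ↦ v C - v` is spanned by any positive fixed vector: subtract the largest
multiple of `c` that stays below `v`; the difference is a nonnegative fixed vector with a zero. -/
theorem eq_sum_mul_of_vecMul_eq_self {n : ℕ} {C : Matrix (Fin n) (Fin n) ℝ}
    (hirr : C.IsIrreducible) {c : Fin n → ℝ} (hc : IsDominantLeftEigenvector C c)
    (hpos : ∀ i, 0 < c i) {v : Fin n → ℝ} (hv : Matrix.vecMul v C = v) (i : Fin n) :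
    v i = (∑ j, v j) * c i := by
  have : Nonempty (Fin n) := ⟨i⟩
  obtain ⟨k, hk⟩ := Finite.exists_min (fun i => v i / c i)
  set t := v k / c k with ht
  have hzero : v - t • c = 0 := by
    by_contra hne
    have h := pos_of_vecMul_eq_self hirr (v := v - t • c) (fun j => ?_) hne ?_ k
    · have : t * c k = v k := by rw [ht]; field_simp [(hpos k).ne']
      simp [this] at h
    · have := (le_div_iff₀ (hpos j)).1 (hk j)
      simpa using this
    · rw [Matrix.sub_vecMul, Matrix.smul_vecMul, hc.2, hv]
  have hvt : ∀ j, v j = t * c j := fun j => by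
    have := congrFun hzero j
    simp only [Pi.sub_apply, Pi.smul_apply, smul_eq_mul, Pi.zero_apply] at this
    linarith
  have hsum : ∑ j, v j = t := by
    simp_rw [hvt, ← Finset.mul_sum, hc.1.2, mul_one]
  rw [hsum, hvt i]

theorem sum_vecMul_of_stochastic {n : ℕ} {C : Matrix (Fin n) (Fin n) ℝ}
    (hC : C ∈ Matrix.rowStochastic ℝ (Fin n)) (v : Fin n → ℝ) :
    ∑ i, Matrix.vecMul v C i = ∑ i, v i := by
  simp only [Matrix.vecMul, dotProduct]
  rw [Finset.sum_comm]
  simp_rw [← Finset.mul_sum, Matrix.sum_row_of_mem_rowStochastic hC, mul_one]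

/-- Existence of the eigenvector centrality scores: `1 - C` is singular because `C 1 = 1`, and the
entrywise absolute value of a left null vector is again one, by conservation of total mass. -/
theorem exists_centrality {n : ℕ} (hn : 0 < n) {C : Matrix (Fin n) (Fin n) ℝ}
    (hC : C ∈ Matrix.rowStochastic ℝ (Fin n)) (hirr : C.IsIrreducible) :
    ∃ c, IsDominantLeftEigenvector C c ∧ ∀ i, 0 < c i := by
  have : Nonempty (Fin n) := ⟨⟨0, hn⟩⟩
  have hdet : (1 - C).det = 0 := by
    rw [← Matrix.exists_mulVec_eq_zero_iff]
    exact ⟨1, one_ne_zero, by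
      rw [Matrix.sub_mulVec, Matrix.one_mulVec, Matrix.one_vecMul_of_mem_rowStochastic hC, sub_self]⟩
  obtain ⟨v, hv0, hv⟩ := Matrix.exists_vecMul_eq_zero_iff.2 hdet
  rw [Matrix.vecMul_sub, Matrix.vecMul_one, sub_eq_zero] at hv
  set a : Fin n → ℝ := fun i => |v i| with ha
  have hle : ∀ i, a i ≤ Matrix.vecMul a C i := fun i => by
    have h := congrFun hv i
    simp only [ha]
    rw [h]
    simp only [Matrix.vecMul, dotProduct]
    refine (Finset.abs_sum_le_sum_abs _ _).trans (Finset.sum_le_sum fun j _ => ?_)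
    rw [abs_mul, abs_of_nonneg (hirr.nonneg j i)]
  have hfix : Matrix.vecMul a C = a := by
    have := (Finset.sum_eq_sum_iff_of_le (fun i _ => hle i)).1 (sum_vecMul_of_stochastic hC a).symm
    exact funext fun i => (this i (Finset.mem_univ i)).symm
  have hane : a ≠ 0 := fun h => hv0 (funext fun i => abs_eq_zero.1 (congrFun h i))
  have hpos := pos_of_vecMul_eq_self hirr (fun i => abs_nonneg _) hane hfix
  have hS : 0 < ∑ i, a i := Finset.sum_pos (fun i _ => hpos i) Finset.univ_nonempty
  refine ⟨(∑ i, a i)⁻¹ • a, ⟨⟨fun i => ?_, ?_⟩, ?_⟩, fun i => ?_⟩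
  · exact mul_nonneg (inv_nonneg.2 hS.le) (hpos i).le
  · simp only [Pi.smul_apply, smul_eq_mul, ← Finset.mul_sum]
    exact inv_mul_cancel₀ hS.ne'
  · rw [Matrix.smul_vecMul, hfix]
  · exact mul_pos (inv_pos.2 hS) (hpos i)

theorem isDominantLeftEigenvector_iff_eq {n : ℕ} {C : Matrix (Fin n) (Fin n) ℝ}
    (hirr : C.IsIrreducible) {c : Fin n → ℝ} (hc : IsDominantLeftEigenvector C c)
    (hpos : ∀ i, 0 < c i) (c' : Fin n → ℝ) : IsDominantLeftEigenvector C c' ↔ c' = c := by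
  refine ⟨fun h => funext fun i => ?_, fun h => h ▸ hc⟩
  rw [eq_sum_mul_of_vecMul_eq_self hirr hc hpos h.2 i, h.1.2, one_mul]

/-! ### States of the simplex -/

theorem le_one_of_mem_simplex {n : ℕ} {x : Fin n → ℝ} (hx : x ∈ stdSimplex ℝ (Fin n))
    (i : Fin n) : x i ≤ 1 :=
  hx.2 ▸ Finset.single_le_sum (fun j _ => hx.1 j) (Finset.mem_univ i)

theorem add_le_one_of_mem_simplex {n : ℕ} {x : Fin n → ℝ} (hx : x ∈ stdSimplex ℝ (Fin n))
    {i j : Fin n} (hij : i ≠ j) : x i + x j ≤ 1 := by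
  rw [← hx.2, ← Finset.sum_pair hij]
  exact Finset.sum_le_sum_of_subset_of_nonneg (Finset.subset_univ _) fun k _ _ => hx.1 k

theorem sum_erase_of_mem_simplex {n : ℕ} {x : Fin n → ℝ} (hx : x ∈ stdSimplex ℝ (Fin n))
    (i : Fin n) : ∑ j ∈ Finset.univ.erase i, x j = 1 - x i := by
  have := Finset.add_sum_erase Finset.univ x (Finset.mem_univ i)
  rw [hx.2] at this
  linarith

theorem eq_single_of_apply_eq_one {n : ℕ} {x : Fin n → ℝ} (hx : x ∈ stdSimplex ℝ (Fin n))
    {i : Fin n} (hi : x i = 1) : x = Pi.single i 1 := by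
  ext j
  rcases eq_or_ne j i with rfl | hj
  · simpa using hi
  · have := add_le_one_of_mem_simplex hx hj
    have := hx.1 j
    rw [Pi.single_eq_of_ne hj]
    linarith

theorem lt_one_of_nonAutocratic {n : ℕ} {x : Fin n → ℝ} (hx : x ∈ nonAutocratic n) (i : Fin n) :
    x i < 1 :=
  lt_of_le_of_ne (le_one_of_mem_simplex hx.1 i) fun h =>
    hx.2 ⟨i, (eq_single_of_apply_eq_one hx.1 h).symm⟩

theorem nonAutocratic_of_lt_one {n : ℕ} {x : Fin n → ℝ} (hx : x ∈ stdSimplex ℝ (Fin n))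
    (h : ∀ i, x i < 1) : x ∈ nonAutocratic n := by
  refine ⟨hx, ?_⟩
  rintro ⟨i, rfl⟩
  simpa using h i

theorem mem_nonAutocratic_of_pos {n : ℕ} (hn : 2 ≤ n) {x : Fin n → ℝ}
    (hx : x ∈ stdSimplex ℝ (Fin n)) (h : ∀ i, 0 < x i) : x ∈ nonAutocratic n := by
  refine nonAutocratic_of_lt_one hx fun i => ?_
  have : Nontrivial (Fin n) := Fin.nontrivial_iff_two_le.2 hn
  obtain ⟨j, hj⟩ := exists_ne i
  linarith [add_le_one_of_mem_simplex hx hj, h j]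

/-! ### The two update rules -/

theorem singleTimescaleStep_apply {n : ℕ} (C : Matrix (Fin n) (Fin n) ℝ) (x : Fin n → ℝ)
    (i : Fin n) :
    singleTimescaleStep C x i = x i ^ 2 + ∑ j, C j i * (x j * (1 - x j)) := by
  simp only [singleTimescaleStep, Pi.add_apply, Matrix.mulVec, dotProduct, Matrix.transpose_apply,
    Pi.sub_apply, Pi.pow_apply]
  rw [add_comm]
  congr 1
  exact Finset.sum_congr rfl fun j _ => by ring

theorem isDFEquilibrium_iff {n : ℕ} {C : Matrix (Fin n) (Fin n) ℝ} {x : Fin n → ℝ} :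
    IsDFEquilibrium C x ↔ IsSingleTimescaleEquilibrium C x := by
  unfold IsDFEquilibrium IsSingleTimescaleEquilibrium IsDominantLeftEigenvector
  rw [singleTimescaleStep_eq, Matrix.mulVec_transpose]

theorem vecMul_influenceMatrix_eq_self_iff {n : ℕ} {C : Matrix (Fin n) (Fin n) ℝ}
    {y w : Fin n → ℝ} :
    Matrix.vecMul w (influenceMatrix C y) = w ↔
      Matrix.vecMul (fun i => w i * (1 - y i)) C = fun i => w i * (1 - y i) := by
  have h : Matrix.vecMul w (influenceMatrix C y) =
      (fun i => w i * y i) + Matrix.vecMul (fun i => w i * (1 - y i)) C := by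
    have h1 : Matrix.vecMul w (Matrix.diagonal y) = fun i => w i * y i :=
      funext fun i => Matrix.vecMul_diagonal _ _ _
    rw [influenceMatrix, Matrix.vecMul_add, h1, ← Matrix.vecMul_vecMul, Matrix.vecMul_sub,
      Matrix.vecMul_one, h1]
    congr 2
    ext i
    simp only [Pi.sub_apply]
    ring
  rw [h]
  constructor
  · intro H
    ext i
    have := congrFun H i
    simp only [Pi.add_apply] at this
    linarith
  · intro H
    rw [H]
    ext i
    simp only [Pi.add_apply]
    ring

/-- `w` follows `y` in the DF model exactly when `w i * (1 - y i)` is proportional to the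
centrality scores. -/
theorem isDominantLeftEigenvector_influenceMatrix_iff {n : ℕ} {C : Matrix (Fin n) (Fin n) ℝ}
    (hirr : C.IsIrreducible) {c : Fin n → ℝ} (hc : IsDominantLeftEigenvector C c)
    (hpos : ∀ i, 0 < c i) {y w : Fin n → ℝ} :
    IsDominantLeftEigenvector (influenceMatrix C y) w ↔
      w ∈ stdSimplex ℝ (Fin n) ∧
        ∀ i, w i * (1 - y i) = (∑ j, w j * (1 - y j)) * c i := by
  unfold IsDominantLeftEigenvector
  rw [vecMul_influenceMatrix_eq_self_iff]
  refine and_congr_right fun _ => ⟨fun h i => eq_sum_mul_of_vecMul_eq_self hirr hc hpos h i, ?_⟩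
  intro h
  have : (fun i => w i * (1 - y i)) = (∑ j, w j * (1 - y j)) • c := funext h
  rw [this, Matrix.smul_vecMul, hc.2]

/-- From a state without autocrat the next state of the DF model is unique, and it is positive:
`w i` is proportional to `c i / (1 - y i)`. -/
theorem existsUnique_df_step {n : ℕ} (hn : 0 < n) {C : Matrix (Fin n) (Fin n) ℝ}
    (hirr : C.IsIrreducible) {c : Fin n → ℝ} (hc : IsDominantLeftEigenvector C c)
    (hpos : ∀ i, 0 < c i) {y : Fin n → ℝ} (hy : ∀ i, y i < 1) :
    ∃ w, (∀ i, 0 < w i) ∧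
      ∀ w', IsDominantLeftEigenvector (influenceMatrix C y) w' ↔ w' = w := by
  have : Nonempty (Fin n) := ⟨⟨0, hn⟩⟩
  have hb : ∀ i, 0 < c i / (1 - y i) := fun i => div_pos (hpos i) (sub_pos.2 (hy i))
  set S := ∑ i, c i / (1 - y i) with hSdef
  have hS : 0 < S := Finset.sum_pos (fun i _ => hb i) Finset.univ_nonempty
  refine ⟨fun i => c i / (1 - y i) / S, fun i => div_pos (hb i) hS, fun w' => ?_⟩
  rw [isDominantLeftEigenvector_influenceMatrix_iff hirr hc hpos]
  constructor
  · rintro ⟨hw, h⟩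
    set a := ∑ j, w' j * (1 - y j)
    have hw' : ∀ i, w' i = a * (c i / (1 - y i)) := fun i => by
      rw [← mul_div_assoc, ← h i, mul_div_cancel_right₀ _ (sub_pos.2 (hy i)).ne']
    have haS : a * S = 1 := by
      rw [hSdef, Finset.mul_sum]
      exact (Finset.sum_congr rfl fun i _ => (hw' i).symm).trans hw.2
    ext i
    rw [hw' i, eq_div_iff hS.ne', mul_right_comm, haS, one_mul]
  · rintro rfl
    have h : ∀ i, c i / (1 - y i) / S * (1 - y i) = S⁻¹ * c i := fun i => by
      have := (sub_pos.2 (hy i)).ne'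
      field_simp
    refine ⟨⟨fun i => (div_pos (hb i) hS).le, ?_⟩, fun i => ?_⟩
    · rw [← Finset.sum_div, ← hSdef, div_self hS.ne']
    · simp_rw [h, ← Finset.mul_sum, hc.1.2, mul_one]

theorem existsUnique_df_trajectory {n : ℕ} (hn : 2 ≤ n) {C : Matrix (Fin n) (Fin n) ℝ}
    (hirr : C.IsIrreducible) {c : Fin n → ℝ} (hc : IsDominantLeftEigenvector C c)
    (hpos : ∀ i, 0 < c i) {x₀ : Fin n → ℝ} (hx : x₀ ∈ nonAutocratic n) :
    ∃! y : ℕ → Fin n → ℝ, IsDFTrajectory C x₀ y := by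
  have key : ∀ y : Fin n → ℝ, ∃ w, y ∈ nonAutocratic n →
      (∀ i, 0 < w i) ∧ ∀ w', IsDominantLeftEigenvector (influenceMatrix C y) w' ↔ w' = w := by
    intro y
    by_cases hy : y ∈ nonAutocratic n
    · obtain ⟨w, hw⟩ := existsUnique_df_step (by omega) hirr hc hpos (lt_one_of_nonAutocratic hy)
      exact ⟨w, fun _ => hw⟩
    · exact ⟨0, fun h => absurd h hy⟩
  choose G hG using key
  have hGmem : ∀ y ∈ nonAutocratic n, G y ∈ nonAutocratic n := fun y hy =>
    mem_nonAutocratic_of_pos hn (((hG y hy).2 _).2 rfl).1 (hG y hy).1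
  have hmem : ∀ s, G^[s] x₀ ∈ nonAutocratic n := by
    intro s
    induction s with
    | zero => exact hx
    | succ s ih => rw [Function.iterate_succ_apply']; exact hGmem _ ih
  refine ⟨fun s => G^[s] x₀, ⟨rfl, fun s => ?_⟩, ?_⟩
  · exact ((hG _ (hmem s)).2 _).2 (Function.iterate_succ_apply' G s x₀)
  · rintro y ⟨hy0, hy⟩
    ext1 s
    induction s with
    | zero => exact hy0
    | succ s ih =>
      have := hy s
      rw [ih] at this
      rw [Function.iterate_succ_apply', ← ((hG _ (hmem s)).2 _).1 this]

theorem df_trajectory_pos {n : ℕ} (hn : 2 ≤ n) {C : Matrix (Fin n) (Fin n) ℝ}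
    (hirr : C.IsIrreducible) {c : Fin n → ℝ} (hc : IsDominantLeftEigenvector C c)
    (hpos : ∀ i, 0 < c i) {x₀ : Fin n → ℝ} (hx : x₀ ∈ nonAutocratic n)
    {y : ℕ → Fin n → ℝ} (hy : IsDFTrajectory C x₀ y) (s : ℕ) :
    y s ∈ nonAutocratic n ∧ ∀ i, 0 < y (s + 1) i := by
  have step : ∀ s, y s ∈ nonAutocratic n → ∀ i, 0 < y (s + 1) i := fun s hs => by
    obtain ⟨w, hw, hiff⟩ := existsUnique_df_step (by omega) hirr hc hpos
      (lt_one_of_nonAutocratic hs)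
    rwa [(hiff _).1 (hy.2 s)]
  have hmem : y s ∈ nonAutocratic n := by
    induction s with
    | zero => rw [hy.1]; exact hx
    | succ s ih => exact mem_nonAutocratic_of_pos hn (hy.2 s).1 (step s ih)
  exact ⟨hmem, step s hmem⟩

/-! ### Convergence from a strict Lyapunov function -/

/-- A sequence in a compact set whose steps tend to zero and which has only finitely many cluster
points converges: its steps are too short to jump from one cluster point to another. -/
theorem exists_tendsto_of_finite_clusterPt {X : Type*} [MetricSpace X] {K : Set X}
    (hK : IsCompact K) {x : ℕ → X} (hx : ∀ t, x t ∈ K)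
    (hstep : Tendsto (fun t => dist (x (t + 1)) (x t)) atTop (𝓝 0)) {E : Set X} (hE : E.Finite)
    (hcl : ∀ p ∈ K, MapClusterPt p atTop x → p ∈ E) : ∃ p ∈ E, Tendsto x atTop (𝓝 p) := by
  obtain ⟨p, hpK, hp⟩ := hK.exists_mapClusterPt (f := atTop) (u := x)
    (tendsto_principal.2 (Eventually.of_forall hx))
  have hpE := hcl p hpK hp
  refine ⟨p, hpE, Metric.tendsto_atTop.2 fun ε hε => ?_⟩
  have hnear := hK.tendsto_nhdsSet_of_mapClusterPt (Eventually.of_forall hx) hcl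
  obtain ⟨δ, hδ, hball⟩ := Metric.isOpen_iff.1 (hE.subset Set.sdiff_subset).isClosed.isOpen_compl p
    (show p ∈ (E \ {p})ᶜ by simp)
  set r := min ε (δ / 3) with hr
  have hr0 : 0 < r := lt_min hε (by positivity)
  have hrδ : 3 * r ≤ δ := by have := min_le_right ε (δ / 3); linarith
  have h1 : ∀ᶠ t in atTop, x t ∈ Metric.thickening r E :=
    hnear (Metric.isOpen_thickening.mem_nhdsSet.2 (Metric.self_subset_thickening hr0 E))
  have h2 : ∀ᶠ t in atTop, dist (x (t + 1)) (x t) < r := hstep.eventually_lt_const hr0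
  obtain ⟨T, hT⟩ := eventually_atTop.1 (h1.and h2)
  obtain ⟨t₀, ht₀, hxt₀⟩ := frequently_atTop.1
    (mapClusterPt_iff_frequently.1 hp _ (Metric.ball_mem_nhds p hr0)) T
  refine ⟨t₀, fun t ht => lt_of_lt_of_le (?_ : dist (x t) p < r) (min_le_left _ _)⟩
  induction t, ht using Nat.le_induction with
  | base => exact hxt₀
  | succ t ht ih =>
    have h := hT t (ht₀.trans ht)
    obtain ⟨q, hqE, hq⟩ := Metric.mem_thickening_iff.1 (hT (t + 1) (by omega)).1
    rcases eq_or_ne q p with rfl | hqp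
    · exact hq
    · refine absurd (⟨hqE, hqp⟩ : q ∈ E \ {p}) (hball ?_)
      rw [Metric.mem_ball]
      have a1 := dist_triangle q (x (t + 1)) p
      have a2 := dist_triangle (x (t + 1)) (x t) p
      have a3 := dist_comm q (x (t + 1))
      linarith [h.2]

theorem tendsto_zero_of_lyapunov {X : Type*} [TopologicalSpace X] {K : Set X} (hK : IsCompact K)
    {V : X → ℝ} (hV : ContinuousOn V K) {x : ℕ → X} (hx : ∀ t, x t ∈ K) {g : ℕ → ℝ}
    (hg : ∀ t, 0 ≤ g t) (hdec : ∀ t, V (x (t + 1)) + g t ≤ V (x t)) :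
    Tendsto g atTop (𝓝 0) := by
  have hanti : Antitone fun t => V (x t) :=
    antitone_nat_of_succ_le fun t => by linarith [hdec t, hg t]
  obtain ⟨m, hm⟩ := hK.bddBelow_image hV
  have hlim := tendsto_atTop_ciInf hanti ⟨m, by
    rintro _ ⟨t, rfl⟩
    exact hm ⟨x t, hx t, rfl⟩⟩
  have hdiff := hlim.sub (hlim.comp (tendsto_add_atTop_nat 1))
  rw [sub_self] at hdiff
  refine squeeze_zero hg (fun t => ?_) hdiff
  have := hdec t
  simp only [Function.comp]
  linarith

theorem tendsto_zero_of_pow_le {a g : ℕ → ℝ} {k : ℕ} (h : ∀ t, |a t| ^ k ≤ g t)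
    (hg : Tendsto g atTop (𝓝 0)) : Tendsto a atTop (𝓝 0) := by
  refine Metric.tendsto_atTop.2 fun ε hε => ?_
  obtain ⟨T, hT⟩ := eventually_atTop.1 (hg.eventually_lt_const (pow_pos hε k))
  refine ⟨T, fun t ht => ?_⟩
  rw [Real.dist_eq, sub_zero]
  exact lt_of_pow_lt_pow_left₀ k hε.le ((h t).trans_lt (hT t ht))

theorem tendsto_dist_succ_of_pi {n : ℕ} {x : ℕ → Fin n → ℝ}
    (h : ∀ i, Tendsto (fun t => x (t + 1) i - x t i) atTop (𝓝 0)) :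
    Tendsto (fun t => dist (x (t + 1)) (x t)) atTop (𝓝 0) := by
  have : Tendsto (fun t => x (t + 1) - x t) atTop (𝓝 0) := tendsto_pi_nhds.2 h
  simpa [dist_eq_norm] using this.norm

/-- The states of the simplex with `p i * (1 - p i)` proportional to `c i`. For the centrality
scores `c` these are the equilibria of both models. -/
def equilibriumSet {n : ℕ} (c : Fin n → ℝ) : Set (Fin n → ℝ) :=
  {p | p ∈ stdSimplex ℝ (Fin n) ∧ ∀ i, p i * (1 - p i) = (∑ j, p j * (1 - p j)) * c i}

theorem isDFEquilibrium_iff_mem_equilibriumSet {n : ℕ} {C : Matrix (Fin n) (Fin n) ℝ}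
    (hirr : C.IsIrreducible) {c : Fin n → ℝ} (hc : IsDominantLeftEigenvector C c)
    (hpos : ∀ i, 0 < c i) {p : Fin n → ℝ} : IsDFEquilibrium C p ↔ p ∈ equilibriumSet c :=
  isDominantLeftEigenvector_influenceMatrix_iff hirr hc hpos

/-! ### The single-timescale model -/

theorem singleTimescaleStep_mem_simplex {n : ℕ} {C : Matrix (Fin n) (Fin n) ℝ}
    (hC : C ∈ Matrix.rowStochastic ℝ (Fin n)) {x : Fin n → ℝ} (hx : x ∈ stdSimplex ℝ (Fin n)) :
    singleTimescaleStep C x ∈ stdSimplex ℝ (Fin n) := by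
  refine ⟨fun i => ?_, ?_⟩
  · rw [singleTimescaleStep_apply]
    refine add_nonneg (sq_nonneg _) (Finset.sum_nonneg fun j _ => mul_nonneg
      (Matrix.nonneg_of_mem_rowStochastic hC)
      (mul_nonneg (hx.1 j) (sub_nonneg.2 (le_one_of_mem_simplex hx j))))
  · simp_rw [singleTimescaleStep_apply, Finset.sum_add_distrib]
    rw [Finset.sum_comm]
    simp_rw [← Finset.sum_mul, Matrix.sum_row_of_mem_rowStochastic hC, one_mul]
    rw [← Finset.sum_add_distrib]
    exact (Finset.sum_congr rfl fun i _ => by ring).trans hx.2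

/-- `v ↦ v C` does not increase `∑ i, v i ^ 2 / c i`, by the Cauchy-Schwarz inequality. -/
theorem sum_vecMul_sq_div_le {n : ℕ} {C : Matrix (Fin n) (Fin n) ℝ}
    (hC : C ∈ Matrix.rowStochastic ℝ (Fin n)) {c : Fin n → ℝ}
    (hc : IsDominantLeftEigenvector C c) (hpos : ∀ i, 0 < c i) (v : Fin n → ℝ) :
    ∑ i, (∑ j, C j i * v j) ^ 2 / c i ≤ ∑ i, v i ^ 2 / c i := by
  have hCnn : ∀ i j, 0 ≤ C i j := fun i j => Matrix.nonneg_of_mem_rowStochastic hC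
  have hfix : ∀ i, ∑ j, C j i * c j = c i := fun i => by
    have := congrFun hc.2 i
    simp only [Matrix.vecMul, dotProduct] at this
    simp_rw [mul_comm (C _ i)]
    exact this
  have h1 : ∀ i, (∑ j, C j i * v j) ^ 2 / c i ≤ ∑ j, C j i * (v j ^ 2 / c j) := fun i => by
    rw [div_le_iff₀ (hpos i), ← hfix i, mul_comm]
    refine Finset.sum_sq_le_sum_mul_sum_of_sq_le_mul _
      (fun j _ => mul_nonneg (hCnn j i) (hpos j).le)
      (fun j _ => mul_nonneg (hCnn j i) (div_nonneg (sq_nonneg _) (hpos j).le)) fun j _ => le_of_eq ?_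
    have := (hpos j).ne'
    field_simp
  refine (Finset.sum_le_sum fun i _ => h1 i).trans_eq ?_
  rw [Finset.sum_comm]
  simp_rw [← Finset.sum_mul, Matrix.sum_row_of_mem_rowStochastic hC, one_mul]

/-- The Lyapunov function of the single-timescale model, with partial derivatives
`x i * (1 - x i) / c i`. -/
noncomputable def singleTimescaleEnergy {n : ℕ} (c x : Fin n → ℝ) : ℝ :=
  ∑ i, (x i ^ 2 / 2 - x i ^ 3 / 3) / c i

theorem singleTimescaleEnergy_step {n : ℕ} {C : Matrix (Fin n) (Fin n) ℝ}
    (hC : C ∈ Matrix.rowStochastic ℝ (Fin n)) {c : Fin n → ℝ}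
    (hc : IsDominantLeftEigenvector C c) (hpos : ∀ i, 0 < c i) (x : Fin n → ℝ) :
    singleTimescaleEnergy c (singleTimescaleStep C x) +
        ∑ i, (singleTimescaleStep C x i - x i) ^ 2 *
          (2 * x i + singleTimescaleStep C x i) / (3 * c i) ≤
      singleTimescaleEnergy c x := by
  have h := sum_vecMul_sq_div_le hC hc hpos fun j => x j * (1 - x j)
  -- With `f = x (1 - x)`, `s = f C` and `x' = x - f + s`, the coordinates of the loss of energy
  -- beyond the claimed one are `(s ^ 2 - f ^ 2) / (2 c)`.
  have key : ∀ i, (singleTimescaleStep C x i ^ 2 / 2 - singleTimescaleStep C x i ^ 3 / 3) / c i +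
      (singleTimescaleStep C x i - x i) ^ 2 *
          (2 * x i + singleTimescaleStep C x i) / (3 * c i) - (x i ^ 2 / 2 - x i ^ 3 / 3) / c i =
      ((∑ j, C j i * (x j * (1 - x j))) ^ 2 / c i - (x i * (1 - x i)) ^ 2 / c i) / 2 := fun i => by
    rw [singleTimescaleStep_apply]
    have := (hpos i).ne'
    field_simp
    ring
  have hsum := Finset.sum_congr (rfl : (Finset.univ : Finset (Fin n)) = _) fun i _ => key i
  rw [Finset.sum_sub_distrib, Finset.sum_add_distrib, ← Finset.sum_div,
    Finset.sum_sub_distrib] at hsum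
  unfold singleTimescaleEnergy
  linarith

theorem continuous_singleTimescaleStep {n : ℕ} (C : Matrix (Fin n) (Fin n) ℝ) :
    Continuous (singleTimescaleStep C) := by
  refine continuous_pi fun i => ?_
  simp_rw [singleTimescaleStep_apply]
  fun_prop

theorem singleTimescaleTrajectory_succ {n : ℕ} (C : Matrix (Fin n) (Fin n) ℝ) (x₀ : Fin n → ℝ)
    (t : ℕ) : singleTimescaleTrajectory C x₀ (t + 1) =
      singleTimescaleStep C (singleTimescaleTrajectory C x₀ t) :=
  Function.iterate_succ_apply' _ _ _

theorem singleTimescaleTrajectory_mem_simplex {n : ℕ} {C : Matrix (Fin n) (Fin n) ℝ}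
    (hC : C ∈ Matrix.rowStochastic ℝ (Fin n)) {x₀ : Fin n → ℝ}
    (hx : x₀ ∈ stdSimplex ℝ (Fin n)) (t : ℕ) :
    singleTimescaleTrajectory C x₀ t ∈ stdSimplex ℝ (Fin n) := by
  induction t with
  | zero => exact hx
  | succ t ih =>
    rw [singleTimescaleTrajectory_succ]
    exact singleTimescaleStep_mem_simplex hC ih

theorem singleTimescaleTrajectory_converges {n : ℕ} {C : Matrix (Fin n) (Fin n) ℝ}
    (hC : C ∈ Matrix.rowStochastic ℝ (Fin n)) (hirr : C.IsIrreducible) {c : Fin n → ℝ}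
    (hc : IsDominantLeftEigenvector C c) (hpos : ∀ i, 0 < c i)
    (hfin : (equilibriumSet c).Finite) {x₀ : Fin n → ℝ} (hx : x₀ ∈ stdSimplex ℝ (Fin n)) :
    ∃ p ∈ equilibriumSet c, Tendsto (singleTimescaleTrajectory C x₀) atTop (𝓝 p) := by
  set x := singleTimescaleTrajectory C x₀ with hxdef
  have hmem := singleTimescaleTrajectory_mem_simplex hC hx
  have hsucc := singleTimescaleTrajectory_succ C x₀
  rw [← hxdef] at hmem hsucc
  set g : ℕ → ℝ := fun t => ∑ i, (x (t + 1) i - x t i) ^ 2 *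
    (2 * x t i + x (t + 1) i) / (3 * c i) with hgdef
  have hterm : ∀ t i, 0 ≤ (x (t + 1) i - x t i) ^ 2 *
      (2 * x t i + x (t + 1) i) / (3 * c i) := fun t i => by
    have h1 := (hmem t).1 i
    have h2 := (hmem (t + 1)).1 i
    have h3 := hpos i
    positivity
  have hg : Tendsto g atTop (𝓝 0) := by
    refine tendsto_zero_of_lyapunov (isCompact_stdSimplex ℝ (Fin n))
      (V := singleTimescaleEnergy c) ?_ hmem (fun t => Finset.sum_nonneg fun i _ => hterm t i)
      fun t => ?_
    · unfold singleTimescaleEnergy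
      fun_prop
    · have := singleTimescaleEnergy_step hC hc hpos (x t)
      rwa [← hsucc] at this
  have hstep : ∀ i, Tendsto (fun t => x (t + 1) i - x t i) atTop (𝓝 0) := fun i => by
    have hg' : Tendsto (fun t => 3 * c i * g t) atTop (𝓝 0) := by
      simpa using hg.const_mul (3 * c i)
    refine tendsto_zero_of_pow_le (k := 3) (fun t => ?_) hg'
    have h1 := (hmem t).1 i
    have h2 := (hmem (t + 1)).1 i
    have h3 := hpos i
    have h4 : |x (t + 1) i - x t i| ≤ 2 * x t i + x (t + 1) i := by
      rw [abs_le]; constructor <;> linarith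
    calc |x (t + 1) i - x t i| ^ 3 = (x (t + 1) i - x t i) ^ 2 * |x (t + 1) i - x t i| := by
          rw [pow_succ, sq_abs]
      _ ≤ (x (t + 1) i - x t i) ^ 2 * (2 * x t i + x (t + 1) i) :=
          mul_le_mul_of_nonneg_left h4 (sq_nonneg _)
      _ = 3 * c i * ((x (t + 1) i - x t i) ^ 2 * (2 * x t i + x (t + 1) i) / (3 * c i)) := by
          field_simp
      _ ≤ 3 * c i * g t := mul_le_mul_of_nonneg_left
          (Finset.single_le_sum (fun j _ => hterm t j) (Finset.mem_univ i)) (by positivity)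
  refine exists_tendsto_of_finite_clusterPt (isCompact_stdSimplex ℝ (Fin n)) hmem
    (tendsto_dist_succ_of_pi hstep) hfin fun p hp hcl => ?_
  obtain ⟨U, hU, hUp⟩ := mapClusterPt_iff_ultrafilter.1 hcl
  rw [← isDFEquilibrium_iff_mem_equilibriumSet hirr hc hpos, isDFEquilibrium_iff]
  refine ⟨hp, ?_⟩
  have h1 : Tendsto (fun t => x (t + 1) - x t) U (𝓝 0) :=
    (tendsto_pi_nhds.2 hstep : Tendsto _ _ (𝓝 (0 : Fin n → ℝ))).mono_left hU
  have h2 := (((continuous_singleTimescaleStep C).tendsto p).comp hUp).sub hUp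
  have h3 : Tendsto (fun t => x (t + 1) - x t) U (𝓝 (singleTimescaleStep C p - p)) := by
    simpa only [hsucc, Function.comp_def] using h2
  exact sub_eq_zero.1 (tendsto_nhds_unique h3 h1)

/-! ### The two-timescale model -/

/-- A quantitative form of `a - b ≤ a * log (a / b)`, from `log t ≤ t - 1` at `t = √(b / a)`. -/
theorem sub_add_sq_le_mul_log_sub {a b : ℝ} (ha : 0 ≤ a) (ha1 : a ≤ 1) (hb : 0 < b)
    (hb1 : b ≤ 1) : a - b + (a - b) ^ 2 / 4 ≤ a * (Real.log a - Real.log b) := by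
  rcases ha.eq_or_lt with rfl | ha
  · nlinarith
  · obtain ⟨s, hs, rfl⟩ : ∃ s, 0 < s ∧ s ^ 2 = a := ⟨√a, Real.sqrt_pos.2 ha, Real.sq_sqrt ha.le⟩
    obtain ⟨r, hr, rfl⟩ : ∃ r, 0 < r ∧ r ^ 2 = b := ⟨√b, Real.sqrt_pos.2 hb, Real.sq_sqrt hb.le⟩
    have h1 := Real.log_le_sub_one_of_pos (div_pos hr hs)
    rw [Real.log_div hr.ne' hs.ne'] at h1
    have h2 := mul_le_mul_of_nonneg_left h1 (by positivity : 0 ≤ 2 * s ^ 2)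
    have h3 : 2 * s ^ 2 * (r / s - 1) = 2 * s * r - 2 * s ^ 2 := by field_simp
    rw [Real.log_pow, Real.log_pow]
    have hs1 : s ≤ 1 := by nlinarith
    have hr1 : r ≤ 1 := by nlinarith
    have h4 : (s - r) ^ 2 * (s + r) ^ 2 ≤ (s - r) ^ 2 * 4 :=
      mul_le_mul_of_nonneg_left (by nlinarith) (sq_nonneg _)
    push_cast
    nlinarith

/-- The Lyapunov function of the two-timescale model: the relative entropy of `y` to `c` plus a
concave function with partial derivatives `log (1 - y i) + 1`. The next state of the model
minimizes the sum of the relative entropy and the linearization of the concave part at the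
current state. -/
noncomputable def dfEnergy {n : ℕ} (c y : Fin n → ℝ) : ℝ :=
  ∑ i, (y i * Real.log (y i) - y i * Real.log (c i) - (1 - y i) * Real.log (1 - y i))

theorem continuous_dfEnergy {n : ℕ} (c : Fin n → ℝ) : Continuous (dfEnergy c) := by
  unfold dfEnergy
  have h : ∀ i, Continuous fun y : Fin n → ℝ => y i := fun i => continuous_apply i
  refine continuous_finsetSum _ fun i _ => ?_
  exact ((Real.continuous_mul_log.comp (h i)).sub ((h i).mul_const _)).sub
    (Real.continuous_mul_log.comp (continuous_const.sub (h i)))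

theorem dfEnergy_step {n : ℕ} {c : Fin n → ℝ} (hpos : ∀ i, 0 < c i) {y w : Fin n → ℝ}
    (hy : y ∈ nonAutocratic n) (hw : w ∈ nonAutocratic n) (hw0 : ∀ i, 0 < w i) {a : ℝ}
    (h : ∀ i, w i * (1 - y i) = a * c i) :
    dfEnergy c w + ∑ i, (y i - w i) ^ 2 / 4 ≤ dfEnergy c y := by
  have key : ∀ i, (w i * Real.log (w i) - w i * Real.log (c i) - (1 - w i) * Real.log (1 - w i)) +
      (y i - w i) ^ 2 / 4 + (2 + Real.log a) * (y i - w i) ≤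
      y i * Real.log (y i) - y i * Real.log (c i) - (1 - y i) * Real.log (1 - y i) := fun i => by
    have hy1 := lt_one_of_nonAutocratic hy i
    have hw1 := lt_one_of_nonAutocratic hw i
    have hy0 := hy.1.1 i
    have ha : 0 < a := by
      have : 0 < a * c i := h i ▸ mul_pos (hw0 i) (sub_pos.2 hy1)
      exact pos_of_mul_pos_left this (hpos i).le
    have hlog := congrArg Real.log (h i)
    rw [Real.log_mul (hw0 i).ne' (sub_pos.2 hy1).ne', Real.log_mul ha.ne' (hpos i).ne'] at hlog
    have e1 := sub_add_sq_le_mul_log_sub hy0 hy1.le (hw0 i) hw1.le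
    have e2 := sub_add_sq_le_mul_log_sub (sub_pos.2 hw1).le (by linarith [hw0 i])
      (sub_pos.2 hy1) (by linarith)
    have e3 : Real.log (c i) = Real.log (w i) + Real.log (1 - y i) - Real.log a := by linarith
    rw [e3]
    nlinarith [sq_nonneg (y i - w i)]
  have hsum := Finset.sum_le_sum fun i (_ : i ∈ Finset.univ) => key i
  rw [Finset.sum_add_distrib, Finset.sum_add_distrib, ← Finset.mul_sum,
    Finset.sum_sub_distrib (f := y), hy.1.2, hw.1.2, sub_self, mul_zero, add_zero] at hsum
  exact hsum

theorem df_trajectory_converges {n : ℕ} (hn : 2 ≤ n) {C : Matrix (Fin n) (Fin n) ℝ}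
    (hirr : C.IsIrreducible) {c : Fin n → ℝ} (hc : IsDominantLeftEigenvector C c)
    (hpos : ∀ i, 0 < c i) (hfin : (equilibriumSet c).Finite) {x₀ : Fin n → ℝ}
    (hx : x₀ ∈ nonAutocratic n) {y : ℕ → Fin n → ℝ} (hy : IsDFTrajectory C x₀ y) :
    ∃ p ∈ equilibriumSet c, Tendsto y atTop (𝓝 p) := by
  have hmem : ∀ s, y s ∈ nonAutocratic n := fun s => (df_trajectory_pos hn hirr hc hpos hx hy s).1
  have hrel : ∀ s i, y (s + 1) i * (1 - y s i) = (∑ j, y (s + 1) j * (1 - y s j)) * c i :=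
    fun s => ((isDominantLeftEigenvector_influenceMatrix_iff hirr hc hpos).1 (hy.2 s)).2
  set g : ℕ → ℝ := fun t => ∑ i, (y t i - y (t + 1) i) ^ 2 / 4
  have hg : Tendsto g atTop (𝓝 0) :=
    tendsto_zero_of_lyapunov (isCompact_stdSimplex ℝ (Fin n)) (V := dfEnergy c)
      (continuous_dfEnergy c).continuousOn (fun t => (hmem t).1)
      (fun t => Finset.sum_nonneg fun i _ => by positivity)
      fun t => dfEnergy_step hpos (hmem t) (hmem (t + 1))
        (df_trajectory_pos hn hirr hc hpos hx hy t).2 (hrel t)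
  have hstep : ∀ i, Tendsto (fun t => y (t + 1) i - y t i) atTop (𝓝 0) := fun i => by
    have hg' : Tendsto (fun t => 4 * g t) atTop (𝓝 0) := by simpa using hg.const_mul 4
    refine tendsto_zero_of_pow_le (k := 2) (fun t => ?_) hg'
    have := Finset.single_le_sum (f := fun i => (y t i - y (t + 1) i) ^ 2 / 4)
      (fun j _ => by positivity) (Finset.mem_univ i)
    rw [sq_abs]
    simp only [g]
    linarith [this, sub_sq_comm (y (t + 1) i) (y t i)]
  refine exists_tendsto_of_finite_clusterPt (isCompact_stdSimplex ℝ (Fin n))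
    (fun t => (hmem t).1) (tendsto_dist_succ_of_pi hstep) hfin fun p hp hcl => ?_
  obtain ⟨U, hU, hUp⟩ := mapClusterPt_iff_ultrafilter.1 hcl
  have h0 : ∀ i, Tendsto (fun t => y t i) U (𝓝 (p i)) := tendsto_pi_nhds.1 hUp
  have h1 : ∀ i, Tendsto (fun t => y (t + 1) i) U (𝓝 (p i)) := fun i => by
    simpa using ((hstep i).mono_left hU).add (h0 i)
  have h2 : ∀ i, Tendsto (fun t => y (t + 1) i * (1 - y t i)) U (𝓝 (p i * (1 - p i))) :=
    fun i => (h1 i).mul ((h0 i).const_sub 1)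
  refine ⟨hp, fun i => tendsto_nhds_unique (h2 i) ?_⟩
  simp_rw [hrel _ i]
  exact (tendsto_finsetSum _ fun j _ => h2 j).mul_const _

/-! ### Equilibria -/

theorem add_lt_one_of_pos {n : ℕ} (hn : 3 ≤ n) {x : Fin n → ℝ} (hx : x ∈ stdSimplex ℝ (Fin n))
    (hx0 : ∀ i, 0 < x i) {i j : Fin n} (hij : i ≠ j) : x i + x j < 1 := by
  obtain ⟨k, hk⟩ : ∃ k, k ∉ ({i, j} : Finset (Fin n)) := by
    by_contra! h
    have h1 := Finset.card_le_card (fun k _ => h k : (Finset.univ : Finset (Fin n)) ⊆ {i, j})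
    have h2 := Finset.card_le_two (a := i) (b := j)
    rw [Finset.card_univ, Fintype.card_fin] at h1
    omega
  rw [← hx.2, ← Finset.sum_pair hij]
  exact Finset.sum_lt_sum_of_subset (Finset.subset_univ _) (Finset.mem_univ k) hk (hx0 k)
    fun l _ _ => hx.1 l

theorem equilibrium_pos {n : ℕ} {c : Fin n → ℝ} (hpos : ∀ i, 0 < c i) {p : Fin n → ℝ}
    (hp : p ∈ equilibriumSet c) (hna : p ∈ nonAutocratic n) :
    0 < ∑ j, p j * (1 - p j) ∧ ∀ i, 0 < p i := by
  have h1 := lt_one_of_nonAutocratic hna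
  have hf : ∀ i, 0 ≤ p i * (1 - p i) := fun i => mul_nonneg (hp.1.1 i) (sub_pos.2 (h1 i)).le
  have ha : 0 < ∑ j, p j * (1 - p j) := by
    refine lt_of_le_of_ne (Finset.sum_nonneg fun i _ => hf i) fun h0 => ?_
    have hz : ∀ i, p i = 0 := fun i => by
      have := hp.2 i
      rw [← h0, zero_mul] at this
      exact (mul_eq_zero.1 this).resolve_right (sub_pos.2 (h1 i)).ne'
    have := hp.1.2
    simp [hz] at this
  refine ⟨ha, fun i => lt_of_le_of_ne (hp.1.1 i) fun h0 => ?_⟩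
  have := hp.2 i
  rw [← h0, zero_mul] at this
  exact (mul_pos ha (hpos i)).ne this

theorem equilibrium_sub_mul {n : ℕ} {c p : Fin n → ℝ} (hp : p ∈ equilibriumSet c)
    (i j : Fin n) :
    (p j - p i) * (1 - (p i + p j)) = (∑ l, p l * (1 - p l)) * (c j - c i) := by
  have h1 := hp.2 i
  have h2 := hp.2 j
  linear_combination h2 - h1

theorem equilibrium_lt {n : ℕ} (hn : 3 ≤ n) {c : Fin n → ℝ} (hpos : ∀ i, 0 < c i)
    {p : Fin n → ℝ} (hp : p ∈ equilibriumSet c) (hna : p ∈ nonAutocratic n) {i j : Fin n}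
    (hij : c i < c j) : p i < p j := by
  obtain ⟨ha, hp0⟩ := equilibrium_pos hpos hp hna
  have h := equilibrium_sub_mul hp i j
  have hne : i ≠ j := by rintro rfl; exact lt_irrefl _ hij
  have h1 := add_lt_one_of_pos hn hp.1 hp0 hne
  have h2 : 0 < (p j - p i) * (1 - (p i + p j)) := h ▸ mul_pos ha (sub_pos.2 hij)
  exact sub_pos.1 (pos_of_mul_pos_left h2 (sub_pos.2 h1).le)

theorem equilibrium_eq {n : ℕ} (hn : 3 ≤ n) {c : Fin n → ℝ} (hpos : ∀ i, 0 < c i)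
    {p : Fin n → ℝ} (hp : p ∈ equilibriumSet c) (hna : p ∈ nonAutocratic n) {i j : Fin n}
    (hij : c i = c j) : p i = p j := by
  rcases eq_or_ne i j with rfl | hne
  · rfl
  have h := equilibrium_sub_mul hp i j
  have h1 := add_lt_one_of_pos hn hp.1 (equilibrium_pos hpos hp hna).2 hne
  rw [hij, sub_self, mul_zero] at h
  linarith [(mul_eq_zero.1 h).resolve_right (sub_pos.2 h1).ne']

/-- As `a ≤ 1 / 2` grows, the small root of `x (1 - x) = κ a (1 - a)` shrinks relative to `a`,
for a fixed ratio `κ < 1`. -/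
theorem mul_lt_mul_of_logistic_ratio {x y a b : ℝ} (hx : 0 < x) (hxa : x < a) (hab : a < b)
    (hb : b ≤ 1 / 2) (hyb : y ≤ b) (h : x * (1 - x) * (b * (1 - b)) = y * (1 - y) * (a * (1 - a))) :
    y * a < x * b := by
  by_contra! hle
  have ha : 0 < a := hx.trans hxa
  have hb0 : 0 < b := ha.trans hab
  obtain ⟨p, rfl⟩ : ∃ p, x = p * a := ⟨x / a, by field_simp⟩
  obtain ⟨q, rfl⟩ : ∃ q, y = q * b := ⟨y / b, by field_simp⟩
  have hp : 0 < p := pos_of_mul_pos_left hx ha.le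
  have hp1 : p < 1 := by nlinarith
  have hq1 : q ≤ 1 := by nlinarith
  have hpq : p ≤ q := by
    have : p * (a * b) ≤ q * (a * b) := by linarith
    exact le_of_mul_le_mul_right this (by positivity)
  have e : p * (1 - p * a) * (1 - b) = q * (1 - q * b) * (1 - a) := by
    have h0 : a * b * (p * (1 - p * a) * (1 - b)) = a * b * (q * (1 - q * b) * (1 - a)) := by
      linarith
    exact mul_left_cancel₀ (by positivity) h0
  have e1 : p * (1 - p * b) ≤ q * (1 - q * b) := by
    have : 0 ≤ (q - p) * (1 - (p + q) * b) := mul_nonneg (by linarith) (by nlinarith)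
    linarith
  have e2 : 0 < p * ((b - a) * (1 - p)) := by
    have := sub_pos.2 hab
    have := sub_pos.2 hp1
    positivity
  have e3 := mul_le_mul_of_nonneg_right e1 (by linarith : 0 ≤ 1 - a)
  nlinarith

/-- There is at most one equilibrium without autocrat. With `k` of maximal centrality and
`m = min (p k) (1 - p k)`, all coordinates of `p` other than `p k` are at most `m ≤ 1 / 2`, where
`x ↦ x * (1 - x)` is increasing, so they are determined by `m`; the case `p k > 1 / 2` is
governed by `mul_lt_mul_of_logistic_ratio`. -/
theorem equilibrium_unique {n : ℕ} (hn : 3 ≤ n) {c : Fin n → ℝ} (hpos : ∀ i, 0 < c i)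
    {p q : Fin n → ℝ} (hp : p ∈ equilibriumSet c) (hpna : p ∈ nonAutocratic n)
    (hq : q ∈ equilibriumSet c) (hqna : q ∈ nonAutocratic n) : p = q := by
  have : Nonempty (Fin n) := ⟨⟨0, by omega⟩⟩
  obtain ⟨k, hk⟩ := Finite.exists_max c
  wlog hle : min (p k) (1 - p k) ≤ min (q k) (1 - q k) generalizing p q
  · exact (this hq hqna hp hpna (le_of_not_ge hle)).symm
  obtain ⟨ha, hp0⟩ := equilibrium_pos hpos hp hpna
  obtain ⟨hb, hq0⟩ := equilibrium_pos hpos hq hqna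
  have hpf := hp.2
  have hqf := hq.2
  set a := ∑ j, p j * (1 - p j)
  set b := ∑ j, q j * (1 - q j)
  have small : ∀ r ∈ equilibriumSet c, r ∈ nonAutocratic n → ∀ j, j ≠ k →
      r j ≤ r k ∧ r j < 1 - r k := fun r hr hna j hj => by
    have h1 := add_lt_one_of_pos hn hr.1 (equilibrium_pos hpos hr hna).2 hj
    refine ⟨?_, by linarith⟩
    rcases (hk j).lt_or_eq with h | h
    · exact (equilibrium_lt hn hpos hr hna h).le
    · exact (equilibrium_eq hn hpos hr hna h).le
  have hps := small p hp hpna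
  have hqs := small q hq hqna
  have hmin : ∀ s : ℝ, min s (1 - s) * (1 - min s (1 - s)) = s * (1 - s) := fun s => by
    rcases min_choice s (1 - s) with h | h <;> rw [h]
    ring
  have hhalf : ∀ s : ℝ, min s (1 - s) ≤ 1 / 2 := fun s => by
    rcases le_total s (1 / 2) with h | h
    · exact (min_le_left _ _).trans h
    · exact (min_le_right _ _).trans (by linarith)
  have hmp := (hmin (p k)).trans (hpf k)
  have hmq := (hmin (q k)).trans (hqf k)
  have hck := hpos k
  rcases hle.lt_or_eq with hlt | heq
  · have hMh := hhalf (q k)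
    set m := min (p k) (1 - p k) with hm
    set M := min (q k) (1 - q k) with hM
    have hab : a < b := by
      have : a * c k < b * c k := by
        rw [← hmp, ← hmq]
        nlinarith
      exact lt_of_mul_lt_mul_right this hck.le
    have hlt_j : ∀ j, j ≠ k → p j < q j := fun j hj => by
      by_contra! h
      have h1 := mul_lt_mul_of_pos_right hab (hpos j)
      rw [← hpf, ← hqf] at h1
      have h2 := hps j hj
      nlinarith
    exfalso
    rcases le_or_gt (p k) (1 - p k) with hc | hc
    · rw [min_eq_left hc] at hm
      have hkk : p k < q k := by
        rw [← hm]
        exact hlt.trans_le (min_le_left _ _)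
      have : ∑ j, p j < ∑ j, q j := Finset.sum_lt_sum_of_nonempty Finset.univ_nonempty fun j _ => by
        rcases eq_or_ne j k with rfl | hj
        · exact hkk
        · exact hlt_j j hj
      rw [hp.1.2, hq.1.2] at this
      exact lt_irrefl _ this
    · rw [min_eq_right hc.le] at hm
      have hratio : ∀ j ∈ Finset.univ.erase k, q j * m < p j * M := fun j hj => by
        have hj := Finset.ne_of_mem_erase hj
        refine mul_lt_mul_of_logistic_ratio (hp0 j) (hm ▸ (hps j hj).2) hlt hMh
          (le_min (hqs j hj).1 (hqs j hj).2.le) ?_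
        rw [hpf, hqf, hmp, hmq]
        ring
      have hne : (Finset.univ.erase k).Nonempty := by
        have : Nontrivial (Fin n) := Fin.nontrivial_iff_two_le.2 (by omega)
        obtain ⟨j, hj⟩ := exists_ne k
        exact ⟨j, Finset.mem_erase.2 ⟨hj, Finset.mem_univ j⟩⟩
      have hs := Finset.sum_lt_sum_of_nonempty hne hratio
      rw [← Finset.sum_mul, ← Finset.sum_mul, sum_erase_of_mem_simplex hp.1,
        sum_erase_of_mem_simplex hq.1, ← hm] at hs
      have hm0 : 0 < m := hm ▸ sub_pos.2 (lt_one_of_nonAutocratic hpna k)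
      have : M ≤ 1 - q k := min_le_right _ _
      nlinarith
  · have hab : a = b := by
      rw [heq, hmq] at hmp
      exact (mul_right_cancel₀ hck.ne' hmp).symm
    have hj : ∀ j, j ≠ k → p j = q j := fun j hj => by
      have h1 : (p j - q j) * (1 - p j - q j) = 0 := by
        have e1 := hpf j
        have e2 := hqf j
        rw [hab] at e1
        linear_combination e1 - e2
      have h2 := hps j hj
      have h3 := hqs j hj
      rcases mul_eq_zero.1 h1 with h | h <;> linarith
    ext j
    rcases eq_or_ne j k with rfl | hjk
    · have h1 := sum_erase_of_mem_simplex hp.1 j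
      have h2 := sum_erase_of_mem_simplex hq.1 j
      rw [Finset.sum_congr rfl fun i hi => hj i (Finset.ne_of_mem_erase hi)] at h1
      linarith
    · exact hj j hjk

theorem finite_equilibriumSet {n : ℕ} (hn : 3 ≤ n) {c : Fin n → ℝ} (hpos : ∀ i, 0 < c i) :
    (equilibriumSet c).Finite := by
  have h : (equilibriumSet c ∩ nonAutocratic n).Subsingleton := fun p hp q hq =>
    equilibrium_unique hn hpos hp.1 hp.2 hq.1 hq.2
  refine ((Set.finite_range fun i => (Pi.single i 1 : Fin n → ℝ)).union h.finite).subset ?_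
  intro p hp
  by_cases hv : p ∈ Set.range fun i => (Pi.single i 1 : Fin n → ℝ)
  · exact Or.inl hv
  · exact Or.inr ⟨hp, hp.1, hv⟩

theorem single_mem_equilibriumSet {n : ℕ} (c : Fin n → ℝ) (k : Fin n) :
    (Pi.single k 1 : Fin n → ℝ) ∈ equilibriumSet c := by
  have h : ∀ i, (Pi.single k 1 : Fin n → ℝ) i * (1 - (Pi.single k 1 : Fin n → ℝ) i) = 0 := by
    intro i
    rcases eq_or_ne i k with rfl | hi
    · simp
    · simp [hi]
  refine ⟨single_mem_stdSimplex ℝ k, fun i => ?_⟩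
  simp only [h, Finset.sum_const_zero, zero_mul]

/-! ### Star topology and centrality -/

theorem sum_mul_eq_centrality {n : ℕ} {C : Matrix (Fin n) (Fin n) ℝ}
    (hC : IsRelativeInteraction C) {c : Fin n → ℝ} (hc : IsDominantLeftEigenvector C c)
    (i : Fin n) : ∑ j ∈ Finset.univ.erase i, c j * C j i = c i := by
  have h := congrFun hc.2 i
  simp only [Matrix.vecMul, dotProduct] at h
  rw [← Finset.add_sum_erase _ _ (Finset.mem_univ i), hC.2 i, mul_zero, zero_add] at h
  exact h

theorem centrality_lt_half {n : ℕ} {C : Matrix (Fin n) (Fin n) ℝ}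
    (hC : IsRelativeInteraction C) {c : Fin n → ℝ} (hc : IsDominantLeftEigenvector C c)
    (hpos : ∀ i, 0 < c i) {k : Fin n} (hk : ¬ IsStarWithCenter C k) : c k < 1 / 2 := by
  by_contra! hge
  apply hk
  have hle : ∀ j ∈ Finset.univ.erase k, c j * C j k ≤ c j := fun j _ =>
    mul_le_of_le_one_right (hpos j).le (Matrix.le_one_of_mem_rowStochastic hC.1)
  have hs := sum_mul_eq_centrality hC hc k
  have he := sum_erase_of_mem_simplex hc.1 k
  have hsum := Finset.sum_le_sum hle
  have heq := (Finset.sum_eq_sum_iff_of_le hle).1 (by linarith)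
  intro i j hi hj
  have h1 : C i k = 1 := by
    have := heq i (Finset.mem_erase.2 ⟨hi, Finset.mem_univ i⟩)
    exact mul_left_cancel₀ (hpos i).ne' (this.trans (mul_one _).symm)
  have hrow := Matrix.sum_row_of_mem_rowStochastic hC.1 i
  have h2 : C i j + C i k ≤ 1 := by
    rw [← hrow, ← Finset.sum_pair hj]
    exact Finset.sum_le_sum_of_subset_of_nonneg (Finset.subset_univ _) fun l _ _ =>
      Matrix.nonneg_of_mem_rowStochastic hC.1
  exact le_antisymm (by linarith) (Matrix.nonneg_of_mem_rowStochastic hC.1)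

theorem centrality_star_center {n : ℕ} {C : Matrix (Fin n) (Fin n) ℝ}
    (hC : IsRelativeInteraction C) {c : Fin n → ℝ} (hc : IsDominantLeftEigenvector C c)
    {k : Fin n} (hk : IsStarWithCenter C k) : c k = 1 / 2 := by
  have hs := sum_mul_eq_centrality hC hc k
  have he := sum_erase_of_mem_simplex hc.1 k
  have h1 : ∀ j ∈ Finset.univ.erase k, c j * C j k = c j := fun j hj => by
    have hrow := Matrix.sum_row_of_mem_rowStochastic hC.1 j
    rw [Finset.sum_eq_single k (fun l _ hl => hk j l (Finset.ne_of_mem_erase hj) hl)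
      (by simp)] at hrow
    rw [hrow, mul_one]
  rw [Finset.sum_congr rfl h1] at hs
  linarith

/-- An equilibrium without autocrat needs all centrality scores below `1 / 2`: since
`p k < 1 - p j` for `j ≠ k`, the sum of the `p j * (1 - p j)` over `j ≠ k` exceeds
`p k * (1 - p k)`, that is `1 - c k > c k`. -/
theorem equilibrium_isAutocratic_of_half_le {n : ℕ} (hn : 3 ≤ n) {c : Fin n → ℝ}
    (hc : c ∈ stdSimplex ℝ (Fin n)) (hpos : ∀ i, 0 < c i) {k : Fin n} (hk : 1 / 2 ≤ c k)
    {p : Fin n → ℝ} (hp : p ∈ equilibriumSet c) : p ∉ nonAutocratic n := by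
  intro hna
  obtain ⟨ha, hp0⟩ := equilibrium_pos hpos hp hna
  have hpf := hp.2
  set a := ∑ j, p j * (1 - p j) with hadef
  have hne : (Finset.univ.erase k).Nonempty := by
    have : Nontrivial (Fin n) := Fin.nontrivial_iff_two_le.2 (by omega)
    obtain ⟨j, hj⟩ := exists_ne k
    exact ⟨j, Finset.mem_erase.2 ⟨hj, Finset.mem_univ j⟩⟩
  have hlt : ∀ j ∈ Finset.univ.erase k, p j * p k < p j * (1 - p j) := fun j hj =>
    mul_lt_mul_of_pos_left (by
      linarith [add_lt_one_of_pos hn hp.1 hp0 (Finset.ne_of_mem_erase hj)]) (hp0 j)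
  have hs := Finset.sum_lt_sum_of_nonempty hne hlt
  simp_rw [hpf] at hs
  rw [← Finset.sum_mul, sum_erase_of_mem_simplex hp.1, ← Finset.mul_sum,
    sum_erase_of_mem_simplex hc] at hs
  have := hpf k
  nlinarith

/-! ### Vertices of low centrality are not limits -/

theorem df_not_tendsto_single {n : ℕ} (hn : 2 ≤ n) {C : Matrix (Fin n) (Fin n) ℝ}
    (hirr : C.IsIrreducible) {c : Fin n → ℝ} (hc : IsDominantLeftEigenvector C c)
    (hpos : ∀ i, 0 < c i) {x₀ : Fin n → ℝ} (hx : x₀ ∈ nonAutocratic n) {y : ℕ → Fin n → ℝ}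
    (hy : IsDFTrajectory C x₀ y) {k : Fin n} (hk : c k < 1 / 2) :
    ¬ Tendsto y atTop (𝓝 (Pi.single k 1)) := by
  intro hlim
  have hlimk : Tendsto (fun s => y s k) atTop (𝓝 1) := by
    simpa using tendsto_pi_nhds.1 hlim k
  have hr : c k / (1 - c k) < 1 := by rw [div_lt_one] <;> linarith
  obtain ⟨T, hT⟩ := eventually_atTop.1 (hlimk.eventually_const_lt hr)
  have hmem : ∀ s, y s ∈ nonAutocratic n := fun s => (df_trajectory_pos hn hirr hc hpos hx hy s).1
  -- The distance `1 - y s k` to the vertex does not decrease near the vertex.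
  have hgrow : ∀ s, T ≤ s → 1 - y s k ≤ 1 - y (s + 1) k := fun s hs => by
    have hw := (df_trajectory_pos hn hirr hc hpos hx hy s).2
    have hrel := ((isDominantLeftEigenvector_influenceMatrix_iff hirr hc hpos).1 (hy.2 s)).2
    set a := ∑ j, y (s + 1) j * (1 - y s j)
    have hj : ∀ j ∈ Finset.univ.erase k, a * c j ≤ y (s + 1) j := fun j _ => by
      rw [← hrel j]
      exact mul_le_of_le_one_right (hw j).le (by linarith [(hmem s).1.1 j])
    have hsum := Finset.sum_le_sum hj
    rw [← Finset.mul_sum, sum_erase_of_mem_simplex hc.1,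
      sum_erase_of_mem_simplex (hmem (s + 1)).1] at hsum
    refine le_trans ?_ hsum
    have h1 := hT (s + 1) (by omega)
    rw [div_lt_iff₀ (by linarith)] at h1
    have h2 := hrel k
    have h3 := sub_pos.2 (lt_one_of_nonAutocratic (hmem s) k)
    have h4 := mul_le_mul_of_nonneg_right h1.le h3.le
    have h5 : (1 - y s k) * c k ≤ a * (1 - c k) * c k := by nlinarith
    exact le_of_mul_le_mul_right h5 (hpos k)
  have hmono : ∀ s, T ≤ s → 1 - y T k ≤ 1 - y s k := fun s hs => by
    induction s, hs using Nat.le_induction with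
    | base => exact le_rfl
    | succ s hs ih => exact ih.trans (hgrow s hs)
  have h0 : Tendsto (fun s => 1 - y s k) atTop (𝓝 0) := by simpa using hlimk.const_sub 1
  have := ge_of_tendsto h0 (eventually_atTop.2 ⟨T, hmono⟩)
  linarith [lt_one_of_nonAutocratic (hmem T) k]

theorem sq_le_singleTimescaleStep {n : ℕ} {C : Matrix (Fin n) (Fin n) ℝ}
    (hC : C ∈ Matrix.rowStochastic ℝ (Fin n)) {x : Fin n → ℝ} (hx : x ∈ stdSimplex ℝ (Fin n))
    (i : Fin n) : x i ^ 2 ≤ singleTimescaleStep C x i := by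
  rw [singleTimescaleStep_apply]
  exact le_add_of_nonneg_right (Finset.sum_nonneg fun j _ => mul_nonneg
    (Matrix.nonneg_of_mem_rowStochastic hC)
    (mul_nonneg (hx.1 j) (sub_nonneg.2 (le_one_of_mem_simplex hx j))))

theorem singleTimescaleStep_mem_nonAutocratic {n : ℕ} {C : Matrix (Fin n) (Fin n) ℝ}
    (hC : C ∈ Matrix.rowStochastic ℝ (Fin n)) {x : Fin n → ℝ} (hx : x ∈ nonAutocratic n) :
    singleTimescaleStep C x ∈ nonAutocratic n := by
  have hmem := singleTimescaleStep_mem_simplex hC hx.1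
  refine nonAutocratic_of_lt_one hmem fun i => ?_
  have h1 := lt_one_of_nonAutocratic hx i
  have h2 := sum_erase_of_mem_simplex hx.1 i
  obtain ⟨j, hj, hj0⟩ : ∃ j ∈ Finset.univ.erase i, 0 < x j := by
    by_contra! h
    linarith [Finset.sum_nonpos h]
  have h3 := add_le_one_of_mem_simplex hmem (Finset.ne_of_mem_erase hj)
  have h4 := sq_le_singleTimescaleStep hC hx.1 j
  have := pow_pos hj0 2
  linarith

theorem singleTimescaleTrajectory_mem_nonAutocratic {n : ℕ} {C : Matrix (Fin n) (Fin n) ℝ}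
    (hC : C ∈ Matrix.rowStochastic ℝ (Fin n)) {x₀ : Fin n → ℝ} (hx : x₀ ∈ nonAutocratic n)
    (t : ℕ) : singleTimescaleTrajectory C x₀ t ∈ nonAutocratic n := by
  induction t with
  | zero => exact hx
  | succ t ih =>
    rw [singleTimescaleTrajectory_succ]
    exact singleTimescaleStep_mem_nonAutocratic hC ih

/-- The support of the state never shrinks, and it grows along the edges of `C`. -/
theorem singleTimescaleTrajectory_eventually_pos {n : ℕ} {C : Matrix (Fin n) (Fin n) ℝ}
    (hC : C ∈ Matrix.rowStochastic ℝ (Fin n)) (hirr : C.IsIrreducible) {x₀ : Fin n → ℝ}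
    (hx : x₀ ∈ nonAutocratic n) :
    ∀ᶠ t in atTop, ∀ i, 0 < singleTimescaleTrajectory C x₀ t i := by
  have hmem := singleTimescaleTrajectory_mem_nonAutocratic hC hx
  have hsucc := singleTimescaleTrajectory_succ C x₀
  set x := singleTimescaleTrajectory C x₀ with hxdef
  have persist : ∀ {i T}, 0 < x T i → ∀ᶠ t in atTop, 0 < x t i := fun {i T} h => by
    refine eventually_atTop.2 ⟨T, fun t ht => ?_⟩
    induction t, ht using Nat.le_induction with
    | base => exact h
    | succ t _ ih =>
      rw [hsucc]
      exact (pow_pos ih 2).trans_le (sq_le_singleTimescaleStep hC (hmem t).1 i)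
  obtain ⟨i₀, hi₀⟩ : ∃ i, 0 < x 0 i := by
    by_contra! h
    linarith [Finset.sum_nonpos fun i (_ : i ∈ Finset.univ) => h i, (hmem 0).1.2]
  refine eventually_all.2 fun i => hirr.forall_of_edge
    (P := fun i => ∀ᶠ t in atTop, 0 < x t i) (persist hi₀) (fun i j hij hi => ?_) i
  obtain ⟨t, ht⟩ := hi.exists
  refine persist (T := t + 1) ?_
  rw [hsucc, singleTimescaleStep_apply]
  refine add_pos_of_nonneg_of_pos (sq_nonneg _) (Finset.sum_pos' (fun l _ => mul_nonneg
    (hirr.nonneg l j) (mul_nonneg ((hmem t).1.1 l)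
      (sub_nonneg.2 (le_one_of_mem_simplex (hmem t).1 l)))) ⟨i, Finset.mem_univ i, ?_⟩)
  exact mul_pos hij (mul_pos ht (sub_pos.2 (lt_one_of_nonAutocratic (hmem t) i)))

/-- Near the vertex `k` with `c k < 1 / 2`, lower bounds `α * c j ≤ x j * (1 - x j)` for `j ≠ k`
persist. They imply the same bound for `j = k`, so the inflow to each `j` is at least `α * c j`,
and `x ↦ x * (1 - x)` is increasing on the coordinates `j ≠ k`. -/
theorem singleTimescaleStep_lower_bound {n : ℕ} {C : Matrix (Fin n) (Fin n) ℝ}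
    (hC : C ∈ Matrix.rowStochastic ℝ (Fin n)) {c : Fin n → ℝ}
    (hc : IsDominantLeftEigenvector C c) {k : Fin n} (hk : c k < 1 / 2) {x : Fin n → ℝ}
    (hx : x ∈ stdSimplex ℝ (Fin n)) (hxk : c k / (1 - c k) < x k)
    (hxk' : 1 / 2 < singleTimescaleStep C x k) {α : ℝ} (hα : 0 ≤ α)
    (h : ∀ j, j ≠ k → α * c j ≤ x j * (1 - x j)) {j : Fin n} (hj : j ≠ k) :
    α * c j ≤ singleTimescaleStep C x j * (1 - singleTimescaleStep C x j) := by
  have hall : ∀ i, α * c i ≤ x i * (1 - x i) := fun i => by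
    rcases eq_or_ne i k with rfl | hi
    · have hle : ∀ l ∈ Finset.univ.erase i, α * c l ≤ x l := fun l hl =>
        (h l (Finset.ne_of_mem_erase hl)).trans
          (mul_le_of_le_one_right (hx.1 l) (by linarith [hx.1 l]))
      have hs := Finset.sum_le_sum hle
      rw [← Finset.mul_sum, sum_erase_of_mem_simplex hc.1, sum_erase_of_mem_simplex hx] at hs
      rw [div_lt_iff₀ (by linarith)] at hxk
      nlinarith [mul_le_mul_of_nonneg_left hs (hx.1 i), mul_le_mul_of_nonneg_left hxk.le hα]
    · exact h i hi
  have hstep : x j ^ 2 + α * c j ≤ singleTimescaleStep C x j := by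
    rw [singleTimescaleStep_apply]
    have hfix := congrFun hc.2 j
    simp only [Matrix.vecMul, dotProduct] at hfix
    rw [← hfix, Finset.mul_sum]
    refine add_le_add_right (Finset.sum_le_sum fun i _ => ?_) _
    have := mul_le_mul_of_nonneg_left (hall i)
      (Matrix.nonneg_of_mem_rowStochastic hC : 0 ≤ C i j)
    linarith
  have hle := add_le_one_of_mem_simplex (singleTimescaleStep_mem_simplex hC hx) hj
  set z := singleTimescaleStep C x j
  have h0 := hall j
  have h1 := hx.1 j
  -- With `e = x j * (1 - x j) - α * c j`, the lower bound on `z` is `x j - e`, whose image under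
  -- `x ↦ x * (1 - x)` is `α * c j + e * (2 * x j - e)`.
  have h2 : α * c j ≤ (x j ^ 2 + α * c j) * (1 - (x j ^ 2 + α * c j)) := by
    have : 0 ≤ (x j * (1 - x j) - α * c j) * (2 * x j - (x j * (1 - x j) - α * c j)) := by
      refine mul_nonneg (by linarith) ?_
      have : 0 ≤ α * c j := mul_nonneg hα (hc.1.1 j)
      nlinarith
    linarith
  nlinarith

theorem singleTimescale_not_tendsto_single {n : ℕ} (hn : 2 ≤ n) {C : Matrix (Fin n) (Fin n) ℝ}
    (hC : C ∈ Matrix.rowStochastic ℝ (Fin n)) (hirr : C.IsIrreducible) {c : Fin n → ℝ}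
    (hc : IsDominantLeftEigenvector C c) (hpos : ∀ i, 0 < c i) {x₀ : Fin n → ℝ}
    (hx : x₀ ∈ nonAutocratic n) {k : Fin n} (hk : c k < 1 / 2) :
    ¬ Tendsto (singleTimescaleTrajectory C x₀) atTop (𝓝 (Pi.single k 1)) := by
  intro hlim
  have hmem := singleTimescaleTrajectory_mem_nonAutocratic hC hx
  have hsucc := singleTimescaleTrajectory_succ C x₀
  have hev := singleTimescaleTrajectory_eventually_pos hC hirr hx
  set x := singleTimescaleTrajectory C x₀ with hxdef
  have hlimk : Tendsto (fun s => x s k) atTop (𝓝 1) := by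
    simpa using tendsto_pi_nhds.1 hlim k
  have hr : c k / (1 - c k) < 1 := by rw [div_lt_one] <;> linarith
  obtain ⟨T, hT⟩ := eventually_atTop.1 ((hlimk.eventually_const_lt hr).and
    ((hlimk.eventually_const_lt (by norm_num : (1 / 2 : ℝ) < 1)).and hev))
  have : Nontrivial (Fin n) := Fin.nontrivial_iff_two_le.2 hn
  obtain ⟨l, hl⟩ := Finite.exists_min fun i => x T i * (1 - x T i) / c i
  set α := x T l * (1 - x T l) / c l with hαdef
  have hα : 0 < α := div_pos (mul_pos ((hT T le_rfl).2.2 l)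
    (sub_pos.2 (lt_one_of_nonAutocratic (hmem T) l))) (hpos l)
  have hinv : ∀ t, T ≤ t → ∀ j, j ≠ k → α * c j ≤ x t j * (1 - x t j) := fun t ht => by
    induction t, ht using Nat.le_induction with
    | base => exact fun j _ => (le_div_iff₀ (hpos j)).1 (hl j)
    | succ t ht ih =>
      intro j hj
      have h2 := (hT (t + 1) (by omega)).2.1
      rw [hsucc] at h2 ⊢
      exact singleTimescaleStep_lower_bound hC hc hk (hmem t).1 (hT t ht).1 h2 hα.le ih hj
  obtain ⟨j, hj⟩ := exists_ne k
  have hlimj : Tendsto (fun s => x s j) atTop (𝓝 0) := by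
    simpa [hj] using tendsto_pi_nhds.1 hlim j
  have h0 : Tendsto (fun s => x s j * (1 - x s j)) atTop (𝓝 0) := by
    simpa using hlimj.mul (hlimj.const_sub 1)
  have := ge_of_tendsto h0 (eventually_atTop.2 ⟨T, fun t ht => hinv t ht j hj⟩)
  linarith [mul_pos hα (hpos j)]

/-! ### Two individuals -/

/-- For `n = 2` every state is an equilibrium: `C` exchanges the two individuals, who have equal
values of `x i * (1 - x i)`. -/
theorem singleTimescaleStep_eq_self_of_two {C : Matrix (Fin 2) (Fin 2) ℝ}
    (hC : IsRelativeInteraction C) {x : Fin 2 → ℝ} (hx : x ∈ stdSimplex ℝ (Fin 2)) :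
    singleTimescaleStep C x = x := by
  have h0 := Matrix.sum_row_of_mem_rowStochastic hC.1 0
  have h1 := Matrix.sum_row_of_mem_rowStochastic hC.1 1
  have hs := hx.2
  simp only [Fin.sum_univ_two, hC.2, zero_add, add_zero] at h0 h1 hs
  ext i
  rw [singleTimescaleStep_apply, Fin.sum_univ_two]
  fin_cases i
  · simp only [Fin.zero_eta, hC.2, h1]
    linear_combination x 0 * hs - x 1 * hs
  · simp only [Fin.mk_one, hC.2, h0]
    linear_combination x 1 * hs - x 0 * hs

theorem bothConvergeTo_self {n : ℕ} {C : Matrix (Fin n) (Fin n) ℝ} {x : Fin n → ℝ}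
    (h : IsSingleTimescaleEquilibrium C x) : BothConvergeTo C x x := by
  have hdf := isDFEquilibrium_iff.2 h
  refine ⟨h, hdf, ?_, fun _ => x, ⟨rfl, fun _ => hdf⟩, tendsto_const_nhds⟩
  have : singleTimescaleTrajectory C x = fun _ => x :=
    funext fun t => Function.iterate_fixed h.2 t
  rw [this]
  exact tendsto_const_nhds

/-! ### The common limit for at least three individuals -/

theorem exists_common_limit {n : ℕ} (hn : 3 ≤ n) {C : Matrix (Fin n) (Fin n) ℝ}
    (hC : IsRelativeInteraction C) (hirr : C.IsIrreducible) {c : Fin n → ℝ}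
    (hc : IsDominantLeftEigenvector C c) (hpos : ∀ i, 0 < c i) :
    ∃ xs ∈ equilibriumSet c, (∀ x₀ ∈ nonAutocratic n, BothConvergeTo C x₀ xs) ∧
      (∀ k, IsStarWithCenter C k → xs = Pi.single k 1) ∧
      ((¬ ∃ k, IsStarWithCenter C k) → xs ∈ nonAutocratic n) := by
  have hfin := finite_equilibriumSet hn hpos
  have hcna : c ∈ nonAutocratic n := mem_nonAutocratic_of_pos (by omega) hc.1 hpos
  -- An equilibrium is a possible limit unless it is a vertex of centrality below `1 / 2`.
  obtain ⟨xs, hxs, hadm, huniq⟩ : ∃ xs ∈ equilibriumSet c,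
      (∀ k, c k < 1 / 2 → xs ≠ Pi.single k 1) ∧
      ∀ p ∈ equilibriumSet c, (∀ k, c k < 1 / 2 → p ≠ Pi.single k 1) → p = xs := by
    obtain ⟨xs, hxs, hlim⟩ := singleTimescaleTrajectory_converges hC.1 hirr hc hpos hfin hcna.1
    have hadm : ∀ k, c k < 1 / 2 → xs ≠ Pi.single k 1 := by
      rintro k hk rfl
      exact singleTimescale_not_tendsto_single (by omega) hC.1 hirr hc hpos hcna hk hlim
    refine ⟨xs, hxs, hadm, fun p hp hpadm => ?_⟩
    by_cases hhalf : ∃ k, 1 / 2 ≤ c k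
    · obtain ⟨k, hk⟩ := hhalf
      have hvertex : ∀ q ∈ equilibriumSet c, (∀ k, c k < 1 / 2 → q ≠ Pi.single k 1) →
          q = Pi.single k 1 := fun q hq hqadm => by
        have hna := equilibrium_isAutocratic_of_half_le hn hc.1 hpos hk hq
        obtain ⟨l, rfl⟩ : q ∈ Set.range fun i => (Pi.single i 1 : Fin n → ℝ) := by
          by_contra hv
          exact hna ⟨hq.1, hv⟩
        rcases eq_or_ne l k with rfl | hl
        · rfl
        · have := add_lt_one_of_pos hn hc.1 hpos hl
          exact absurd rfl (hqadm l (by linarith))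
      rw [hvertex p hp hpadm, hvertex xs hxs hadm]
    · push Not at hhalf
      have hna : ∀ q ∈ equilibriumSet c, (∀ k, c k < 1 / 2 → q ≠ Pi.single k 1) →
          q ∈ nonAutocratic n := by
        refine fun q hq hqadm => ⟨hq.1, ?_⟩
        rintro ⟨l, rfl⟩
        exact hqadm l (hhalf l) rfl
      exact equilibrium_unique hn hpos hp (hna p hp hpadm) hxs (hna xs hxs hadm)
  refine ⟨xs, hxs, fun x₀ hx => ?_, fun k hk => ?_, fun hns => ⟨hxs.1, ?_⟩⟩
  · have hdf := (isDFEquilibrium_iff_mem_equilibriumSet hirr hc hpos).2 hxs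
    refine ⟨isDFEquilibrium_iff.1 hdf, hdf, ?_, ?_⟩
    · obtain ⟨p, hp, hlim⟩ := singleTimescaleTrajectory_converges hC.1 hirr hc hpos hfin hx.1
      rwa [huniq p hp] at hlim
      rintro k hk rfl
      exact singleTimescale_not_tendsto_single (by omega) hC.1 hirr hc hpos hx hk hlim
    · obtain ⟨y, hy, -⟩ := existsUnique_df_trajectory (by omega) hirr hc hpos hx
      obtain ⟨p, hp, hlim⟩ := df_trajectory_converges (by omega) hirr hc hpos hfin hx hy
      refine ⟨y, hy, ?_⟩
      rwa [huniq p hp] at hlim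
      rintro k hk rfl
      exact df_not_tendsto_single (by omega) hirr hc hpos hx hy hk hlim
  · refine (huniq _ (single_mem_equilibriumSet c k) fun l hl h => ?_).symm
    have hck := centrality_star_center hC hc hk
    have := congrFun h k
    rcases eq_or_ne k l with rfl | hkl
    · linarith
    · simp [hkl] at this
  · rintro ⟨k, hk⟩
    exact hadm k (centrality_lt_half hC hc hpos fun h => hns ⟨k, h⟩) hk.symm

/-! ### Comparison of social power with centrality -/

theorem equilibrium_div_lt {n : ℕ} (hn : 3 ≤ n) {c : Fin n → ℝ} (hpos : ∀ i, 0 < c i)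
    {p : Fin n → ℝ} (hp : p ∈ equilibriumSet c) (hna : p ∈ nonAutocratic n) {i j : Fin n}
    (hij : c i < c j) : p i / c i < p j / c j := by
  have ha := (equilibrium_pos hpos hp hna).1
  have hdiv : ∀ i, p i / c i = (∑ l, p l * (1 - p l)) / (1 - p i) := fun i => by
    rw [div_eq_div_iff (hpos i).ne' (sub_pos.2 (lt_one_of_nonAutocratic hna i)).ne', hp.2 i]
  rw [hdiv, hdiv]
  exact div_lt_div_of_pos_left ha (sub_pos.2 (lt_one_of_nonAutocratic hna j))
    (by linarith [equilibrium_lt hn hpos hp hna hij])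

/-- The threshold is the least centrality among the individuals with `c i ≤ p i`. -/
theorem equilibrium_exists_threshold {n : ℕ} (hn : 3 ≤ n) {c : Fin n → ℝ}
    (hc : c ∈ stdSimplex ℝ (Fin n)) (hpos : ∀ i, 0 < c i) {p : Fin n → ℝ}
    (hp : p ∈ equilibriumSet c) (hna : p ∈ nonAutocratic n) :
    ∃ θ : ℝ, ∀ i, (θ ≤ c i → c i ≤ p i) ∧ (θ < c i → c i < p i) ∧ (c i < θ → p i < c i) := by
  have hne : (Finset.univ.filter fun i => c i ≤ p i).Nonempty := by
    by_contra! h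
    have hlt : ∀ i, p i < c i := fun i => by
      have := Finset.filter_eq_empty_iff.1 h (Finset.mem_univ i)
      exact not_le.1 this
    have : Nonempty (Fin n) := ⟨⟨0, by omega⟩⟩
    have := Finset.sum_lt_sum_of_nonempty Finset.univ_nonempty fun i _ => hlt i
    rw [hc.2, hp.1.2] at this
    exact lt_irrefl _ this
  obtain ⟨m, hm, hmin⟩ := Finset.exists_min_image _ c hne
  have hm := (Finset.mem_filter.1 hm).2
  have hstrict : ∀ i, c m < c i → c i < p i := fun i hi =>
    (one_lt_div (hpos i)).1 (((one_le_div (hpos m)).2 hm).trans_lt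
      (equilibrium_div_lt hn hpos hp hna hi))
  refine ⟨c m, fun i => ⟨fun hi => ?_, hstrict i, fun hi => ?_⟩⟩
  · rcases hi.lt_or_eq with h | h
    · exact (hstrict i h).le
    · rw [← h, ← equilibrium_eq hn hpos hp hna h]
      exact hm
  · by_contra! h
    exact hi.not_ge (hmin i (Finset.mem_filter.2 ⟨Finset.mem_univ i, h⟩))

theorem lemma1 (n : ℕ) (hn : 2 ≤ n) (C : Matrix (Fin n) (Fin n) ℝ)
    (hC : IsRelativeInteraction C) (hirr : C.IsIrreducible) :
    -- the DF model is well defined from every non-autocratic initial state, and both models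
    -- converge to the same equilibrium
    (∀ x₀ ∈ nonAutocratic n,
      (∃! y : ℕ → Fin n → ℝ, IsDFTrajectory C x₀ y) ∧ ∃ xs, BothConvergeTo C x₀ xs) ∧
    -- for `n ≥ 3` this equilibrium depends on `C` alone, and social power accumulates at the
    -- individuals with high eigenvector centrality
    (3 ≤ n → ∃ c xs : Fin n → ℝ,
      (∀ c', IsDominantLeftEigenvector C c' ↔ c' = c) ∧
      (∀ i, 0 < c i) ∧
      (∀ x₀ ∈ nonAutocratic n, BothConvergeTo C x₀ xs) ∧
      (∀ k, IsStarWithCenter C k → (∀ i, i ≠ k → c i < c k) ∧ xs = Pi.single k 1) ∧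
      ((¬ ∃ k, IsStarWithCenter C k) →
        (∀ i, 0 < xs i) ∧
        (∀ i j, c i = c j → xs i = xs j) ∧
        (∀ i j, c i < c j → xs i < xs j ∧ xs i / c i < xs j / c j)) ∧
      ∃ θ : ℝ, ∀ i, (θ ≤ c i → c i ≤ xs i) ∧ (θ < c i → c i < xs i) ∧ (c i < θ → xs i < c i)) := by
  obtain ⟨c, hc, hpos⟩ := exists_centrality (by omega) hC.1 hirr
  have hbig : 3 ≤ n → ∃ c xs : Fin n → ℝ,
      (∀ c', IsDominantLeftEigenvector C c' ↔ c' = c) ∧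
      (∀ i, 0 < c i) ∧
      (∀ x₀ ∈ nonAutocratic n, BothConvergeTo C x₀ xs) ∧
      (∀ k, IsStarWithCenter C k → (∀ i, i ≠ k → c i < c k) ∧ xs = Pi.single k 1) ∧
      ((¬ ∃ k, IsStarWithCenter C k) →
        (∀ i, 0 < xs i) ∧
        (∀ i j, c i = c j → xs i = xs j) ∧
        (∀ i j, c i < c j → xs i < xs j ∧ xs i / c i < xs j / c j)) ∧
      ∃ θ : ℝ, ∀ i, (θ ≤ c i → c i ≤ xs i) ∧ (θ < c i → c i < xs i) ∧
        (c i < θ → xs i < c i) := fun hn3 => by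
    obtain ⟨xs, hxs, hconv, hstar, hnostar⟩ := exists_common_limit hn3 hC hirr hc hpos
    have hlt : ∀ k, IsStarWithCenter C k → ∀ i, i ≠ k → c i < c k := fun k hk i hi => by
      have := centrality_star_center hC hc hk
      linarith [add_lt_one_of_pos hn3 hc.1 hpos hi]
    refine ⟨c, xs, isDominantLeftEigenvector_iff_eq hirr hc hpos, hpos, hconv,
      fun k hk => ⟨hlt k hk, hstar k hk⟩, fun hns => ?_, ?_⟩
    · have hna := hnostar hns
      exact ⟨(equilibrium_pos hpos hxs hna).2, fun i j => equilibrium_eq hn3 hpos hxs hna,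
        fun i j hij => ⟨equilibrium_lt hn3 hpos hxs hna hij,
          equilibrium_div_lt hn3 hpos hxs hna hij⟩⟩
    · by_cases hs : ∃ k, IsStarWithCenter C k
      · obtain ⟨k, hk⟩ := hs
        have hk1 : c k ≤ 1 := le_one_of_mem_simplex hc.1 k
        rw [hstar k hk]
        have hmax : ∀ i, c k ≤ c i → i = k := fun i hi => by
          by_contra hne
          exact (hlt k hk i hne).not_ge hi
        refine ⟨c k, fun i => ⟨fun hi => ?_, fun hi => ?_, fun hi => ?_⟩⟩
        · rw [hmax i hi]
          simpa using hk1
        · rw [hmax i hi.le] at hi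
          exact absurd hi (lt_irrefl _)
        · have hne : i ≠ k := by rintro rfl; exact lt_irrefl _ hi
          simpa [hne] using hpos i
      · exact equilibrium_exists_threshold hn3 hc.1 hpos hxs (hnostar hs)
  refine ⟨fun x₀ hx => ⟨existsUnique_df_trajectory hn hirr hc hpos hx, ?_⟩, hbig⟩
  rcases hn.lt_or_eq with h3 | rfl
  · obtain ⟨-, xs, -, -, hconv, -⟩ := hbig h3
    exact ⟨xs, hconv x₀ hx⟩
  · exact ⟨x₀, bothConvergeTo_self ⟨hx.1, singleTimescaleStep_eq_self_of_two hC hx.1⟩⟩
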